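/- Let $p$ be a prime, $e\ge 1$, $q=p^e$, and let $\mathbb F_q$ be the field with $q$ elements. For $i\ge 1$ let $I_i$ be the set of monic irreducible polynomials of degree $i$ over $\mathbb F_q$, and write $[\![P]\!]=1$ if $P$ is true and $[\![P]\!]=0$ otherwise. For a monic polynomial $f=x^d+f_1x^{d-1}+\cdots+f_d$ (with $f_j=0$ for $j>d$) let $\langle f\rangle = x^d f(1/x) \bmod x^2 = 1+f_1x \bmod x^2$. Let $T$ be a finite set of positive integers, $m\ge 0$ an integer, $r_i\ge 0$ an integer for each $i\in T$, and $\alpha\in\mathbb F_q$. Let $N\bigl(m,\prod_{i\in T}I_i^{r_i},\langle x+\alpha\rangle\bigr)$ be the number of monic polynomials $g\in\mathbb F_q[x]$ of degree $m$ with $\langle g\rangle=\langle x+\alpha\rangle$ which, for each $i\in T$, have exactly $r_i$ distinct monic irreducible factors of degree $i$. Set $$v(\alpha)=q[\![\alpha=0]\!]-1,\qquad a_i=\frac1{iq}\sum_{k\mid i,\ p\nmid k}\mu(k)q^{i/k},\qquad b_i=\frac1i\sum_{k\mid i,\ p\mid k}\mu(k)q^{i/k},$$ where $\mu$ is the Möbius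 function, and, for integers $k\ge 0$, with generalized binomial coefficients $\binom{x}{j}=x(x-1)\cdots(x-j+1)/j!$, $$A_k(a,0)=[\![p\mid k]\!]\binom{aq/p}{k/p}(-1)^{k+k/p},\qquad A_k(a,b)=\sum_{j=0}^{\lfloor k/p\rfloor}\binom{aq/p}{j}\binom{b}{k-pj}(-1)^{j+pj}\quad(b\ne 0).$$ Then $$\begin{aligned}N\Bigl(m,\prod_{i\in T}I_i^{r_i},\langle x+\alpha\rangle\Bigr)={}&q^{m-1}\sum_{(j_i)_{i\in T}}\Bigl[\!\!\Bigl[\,\sum_{i\in T}i(r_i+j_i)\le m\Bigr]\!\!\Bigr]\prod_{i\in T}\binom{|I_i|}{r_i}q^{-ir_i}\,q^{-ij_i}\binom{|I_i|-r_i}{j_i}(-1)^{j_i}\\&+\frac{v(\alpha)}{q}\sum_{(k_i)_{i\in T}}\Bigl[\!\!\Bigl[\,\sum_{i\in T}ik_i=m\Bigr]\!\!\Bigr]\prod_{i\in T}A_{k_i}(a_i,b_i)\binom{k_i}{r_i}(-1)^{k_i-r_i},\end{aligned}$$ where the first sum runs over all families of integers with $0\le j_i\le |I_i|-r_i$ for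 each $i\in T$ (it is $0$ if $r_i>|I_i|$ for some $i\in T$), and the second over all families of integers $k_i\ge 0$, $i\in T$. -/

import Mathlib

open Polynomial

namespace PolyPattern

noncomputable section

/-- `⟨f⟩_w = x^{deg f} f(1/x) mod x^{w+1}`, an element of `F[x]/(x^{w+1})`. -/
def bracket {F : Type*} [Field F] (w : ℕ) (f : F[X]) : F[X] ⧸ Ideal.span {(X : F[X]) ^ (w + 1)} :=
  Ideal.Quotient.mk _ f.reverse

/-- `I_i`: the monic irreducible polynomials of degree `i` over `F`. -/
def irred (F : Type*) [Field F] (i : ℕ) : Set F[X] :=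
  {h | h.Monic ∧ Irreducible h ∧ h.natDegree = i}

/-- `r_i(g)`: the number of distinct monic irreducible factors of `g` of degree `i`. -/
def numFactors {F : Type*} [Field F] (i : ℕ) (g : F[X]) : ℕ :=
  {h ∈ irred F i | h ∣ g}.ncard

/-- `N(m, ∏_{i ∈ T} I_i^{r_i}, ⟨f⟩_w)`: the number of monic polynomials `g` of degree `m` with
`⟨g⟩_w = ⟨f⟩_w` that have exactly `r_i` distinct monic irreducible factors of degree `i`, for
every `i ∈ T`. -/
def N {F : Type*} [Field F] (w m : ℕ) (T : Finset ℕ) (r : ℕ → ℕ) (f : F[X]) : ℕ :=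
  {g : F[X] | g.Monic ∧ g.natDegree = m ∧ bracket w g = bracket w f ∧
    ∀ i ∈ T, numFactors i g = r i}.ncard

/-- `a_i = (1/(iq)) ∑_{k ∣ i, p ∤ k} μ(k) q^{i/k}`. -/
def aCoeff (p q i : ℕ) : ℚ :=
  1 / ((i : ℚ) * q) *
    ∑ k ∈ i.divisors with ¬ p ∣ k, (ArithmeticFunction.moebius k : ℚ) * (q : ℚ) ^ (i / k)

/-- `b_i = (1/i) ∑_{k ∣ i, p ∣ k} μ(k) q^{i/k}`. -/
def bCoeff (p q i : ℕ) : ℚ :=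
  1 / (i : ℚ) *
    ∑ k ∈ i.divisors with p ∣ k, (ArithmeticFunction.moebius k : ℚ) * (q : ℚ) ^ (i / k)

/-- The numbers `A_m(a, b)`. `Ring.choose x k = x (x - 1) ⋯ (x - k + 1) / k!` is the generalized
binomial coefficient; it is needed since `b` may be negative. -/
def A (p q m : ℕ) (a b : ℚ) : ℚ :=
  if b = 0 then
    if p ∣ m then Ring.choose (a * q / p) (m / p) * (-1) ^ (m + m / p) else 0
  else
    ∑ j ∈ Finset.range (m / p + 1),
      Ring.choose (a * q / p) j * Ring.choose b (m - p * j) * (-1) ^ (j + p * j)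

open Classical in
/-- `v(α) = q ⟦α = 0⟧ - 1`. -/
def v {F : Type*} [Field F] (α : F) : ℚ :=
  (Nat.card F : ℚ) * (if α = 0 then 1 else 0) - 1

/-- The main term, the sums running over all families `(j_i)_{i ∈ T}` with
`0 ≤ j_i ≤ |I_i| - r_i`. If `r_i > |I_i|` for some `i ∈ T`, then the whole term is `0`, as the
factor `|I_i|.choose r_i` vanishes. -/
def mainTerm (F : Type*) [Field F] (m : ℕ) (T : Finset ℕ) (r : ℕ → ℕ) : ℚ :=
  (Nat.card F : ℚ) ^ ((m : ℤ) - 1) *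
    ∑ j ∈ Fintype.piFinset (fun i : T => Finset.range ((irred F i).ncard - r i + 1)),
      (∏ i : T, (((irred F i).ncard.choose (r i) : ℚ) * (Nat.card F : ℚ) ^ (-((i : ℤ) * r i)) *
        ((Nat.card F : ℚ) ^ (-((i : ℤ) * j i)) *
          (((irred F i).ncard - r i).choose (j i) : ℚ) * (-1) ^ (j i)))) *
      (if ∑ i : T, (i : ℕ) * (r i + j i) ≤ m then 1 else 0)

/-- The sum over all families `(k_i)_{i ∈ T}` of natural numbers with `∑_{i ∈ T} i k_i = m` of
`∏_{i ∈ T} A_{k_i}(a_i, b_i) (k_i choose r_i) (-1)^{k_i - r_i}`. When all elements of `T` are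
positive, the bracket condition forces `k_i ≤ m`, so that it is enough to let each `k_i` run over
`0, …, m`. -/
def secondTerm (p q m : ℕ) (T : Finset ℕ) (r : ℕ → ℕ) : ℚ :=
  ∑ k ∈ Fintype.piFinset (fun _ : T => Finset.range (m + 1)),
    (∏ i : T, (A p q (k i) (aCoeff p q i) (bCoeff p q i) * ((k i).choose (r i) : ℚ) *
      (-1) ^ ((k i : ℤ) - (r i : ℤ)))) *
    (if ∑ i : T, (i : ℕ) * k i = m then 1 else 0)

end

end PolyPattern

/-! For monic `g` the bracket condition only fixes the second coefficient `g.nextCoeff`, which is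
additive on products of monic polynomials, so additive characters `ψ` of `F` detect it
(`card_mul_N_eq_sum`) and `g ↦ ψ g.nextCoeff` is multiplicative. Binomial inversion turns exact
numbers of factors into sums over sets of irreducibles whose product divides `g`. Summing over the
cofactor then leaves elementary symmetric functions of the values `ψ P.nextCoeff` times a complete
character sum (`patternSum_eq`). The trivial character gives `mainTerm`. For `ψ ≠ 1` the cofactor
sum vanishes unless the cofactor is `1`, whence the condition `∑ i * k i = m` in `secondTerm`. The
symmetric functions have generating series `∏ (1 + ψ(P₁) z)`, with `P₁` the second coefficient of
`P`. Counting traces in extension fields shows that each nonzero value is the second coefficient of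
`a_i` irreducibles of degree `i`, and zero of `a_i + b_i`. The series is therefore `(1 -
(-z)^p)^(a_i q / p) * (1 + z)^(b_i)`, with coefficients `A` (`irredEsymm_eq_A`), whichever
nontrivial `ψ` is used. -/

namespace PolyPattern

noncomputable section

/-! ### Character sums over monic polynomials -/

section Monic

variable (F : Type*) [Field F] [Finite F]

/-- Monic polynomials of degree `n` are determined by their `n` lower coefficients. -/
def monicEquivFun (n : ℕ) : {g : F[X] // g.Monic ∧ g.natDegree = n} ≃ (Fin n → F) :=
  (monicEquivDegreeLT n).trans (degreeLTEquiv F n).toEquiv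

theorem finite_monic (n : ℕ) : {g : F[X] | g.Monic ∧ g.natDegree = n}.Finite :=
  Finite.of_equiv _ (monicEquivFun F n).symm

theorem finite_irred (i : ℕ) : (irred F i).Finite :=
  (finite_monic F i).subset fun _ h => ⟨h.1, h.2.2⟩

/-- The finite set of monic polynomials of degree `n`. -/
def monicFinset (n : ℕ) : Finset F[X] := (finite_monic F n).toFinset

/-- The finite set of monic irreducible polynomials of degree `i`. -/
def irredFinset (i : ℕ) : Finset F[X] := (finite_irred F i).toFinset

variable {F}

@[simp]
theorem mem_monicFinset {n : ℕ} {g : F[X]} :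
    g ∈ monicFinset F n ↔ g.Monic ∧ g.natDegree = n := by
  simp [monicFinset]

@[simp]
theorem mem_irredFinset {i : ℕ} {g : F[X]} :
    g ∈ irredFinset F i ↔ g.Monic ∧ Irreducible g ∧ g.natDegree = i := by
  simp [irredFinset, irred]

theorem card_irredFinset (i : ℕ) : (irredFinset F i).card = (irred F i).ncard :=
  (Set.ncard_eq_toFinset_card _ (finite_irred F i)).symm

theorem card_monicFinset (n : ℕ) : (monicFinset F n).card = Nat.card F ^ n := by
  have h := Nat.card_congr (monicEquivFun F n)
  rw [Nat.card_fun, Nat.card_fin] at h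
  rw [← h, monicFinset, ← Set.ncard_eq_toFinset_card _ (finite_monic F n)]
  exact (Nat.card_coe_set_eq _).symm

/-- In positive degree, shifting the second coefficient by `b` with `ψ b ≠ 1` permutes the monic
polynomials and multiplies the sum by `ψ b`. -/
theorem sum_monicFinset_addChar {ψ : AddChar F ℂ} (hψ : ψ ≠ 1) (n : ℕ) :
    ∑ g ∈ monicFinset F n, ψ g.nextCoeff = if n = 0 then 1 else 0 := by
  rcases n with _ | n
  · have : monicFinset F 0 = {1} := by
      ext g
      simp only [mem_monicFinset, Finset.mem_singleton]
      exact ⟨fun h => h.1.natDegree_eq_zero.1 h.2, fun h => by simp [h]⟩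
    have h1 : (1 : F[X]).nextCoeff = 0 := nextCoeff_C_eq_zero 1
    simp [this, h1]
  · obtain ⟨b, hb⟩ := AddChar.ne_one_iff.1 hψ
    have hdeg (b : F) : (C b * X ^ n).degree < ((n + 1 : ℕ) : WithBot ℕ) :=
      (degree_C_mul_X_pow_le n b).trans_lt (by exact_mod_cast Nat.lt_succ_self n)
    have key (b : F) (g : F[X]) (hg : g ∈ monicFinset F (n + 1)) :
        g + C b * X ^ n ∈ monicFinset F (n + 1) := by
      rw [mem_monicFinset] at hg ⊢
      have h1 : (C b * X ^ n).degree < g.degree := by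
        rw [degree_eq_natDegree hg.1.ne_zero, hg.2]
        exact hdeg b
      exact ⟨hg.1.add_of_left h1, by rw [natDegree_add_eq_left_of_degree_lt h1, hg.2]⟩
    have hnext (g : F[X]) (hg : g ∈ monicFinset F (n + 1)) : g.nextCoeff = g.coeff n := by
      rw [nextCoeff_of_natDegree_pos (by rw [(mem_monicFinset.1 hg).2]; omega),
        (mem_monicFinset.1 hg).2, Nat.add_sub_cancel]
    have h : ∑ g ∈ monicFinset F (n + 1), ψ g.nextCoeff =
        ψ b * ∑ g ∈ monicFinset F (n + 1), ψ g.nextCoeff := by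
      rw [Finset.mul_sum]
      symm
      refine Finset.sum_nbij' (fun g => g + C b * X ^ n) (fun g => g + C (-b) * X ^ n)
        (key b) (key (-b)) (by intros; simp) (by intros; simp) fun g hg => ?_
      rw [hnext _ (key b g hg), hnext g hg, coeff_add, coeff_C_mul_X_pow, if_pos rfl,
        AddChar.map_add_eq_mul, mul_comm]
    rw [if_neg (Nat.succ_ne_zero n)]
    have h' : (ψ b - 1) * ∑ g ∈ monicFinset F (n + 1), ψ g.nextCoeff = 0 := by
      rw [sub_mul, one_mul, ← h, sub_self]
    exact (mul_eq_zero.1 h').resolve_left (sub_ne_zero.2 hb)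

open Classical in
theorem sum_monicFinset_dvd (ψ : AddChar F ℂ) (m : ℕ) {Q : F[X]} (hQ : Q.Monic) :
    ∑ g ∈ monicFinset F m with Q ∣ g, ψ g.nextCoeff =
      if Q.natDegree ≤ m then
        ψ Q.nextCoeff * ∑ h ∈ monicFinset F (m - Q.natDegree), ψ h.nextCoeff
      else 0 := by
  split_ifs with hm
  · rw [Finset.mul_sum]
    symm
    refine Finset.sum_bij (fun h _ => Q * h) ?_ ?_ ?_ ?_
    · intro h hh
      rw [mem_monicFinset] at hh
      rw [Finset.mem_filter, mem_monicFinset, hQ.natDegree_mul hh.1, hh.2]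
      exact ⟨⟨hQ.mul hh.1, by omega⟩, dvd_mul_right _ _⟩
    · exact fun a _ b _ hab => mul_left_cancel₀ hQ.ne_zero hab
    · intro g hg
      rw [Finset.mem_filter, mem_monicFinset] at hg
      obtain ⟨⟨hg1, hg2⟩, h, rfl⟩ := hg
      have hh : h.Monic := hQ.of_mul_monic_left hg1
      rw [hQ.natDegree_mul hh] at hg2
      exact ⟨h, mem_monicFinset.2 ⟨hh, by omega⟩, rfl⟩
    · intro h hh
      rw [hQ.nextCoeff_mul (mem_monicFinset.1 hh).1, AddChar.map_add_eq_mul]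
  · refine Finset.sum_eq_zero fun g hg => ?_
    rw [Finset.mem_filter, mem_monicFinset] at hg
    exact absurd (hg.1.2 ▸ natDegree_le_of_dvd hg.2 hg.1.1.ne_zero) hm

theorem isCoprime_of_mem_irredFinset {i j : ℕ} {P Q : F[X]} (hP : P ∈ irredFinset F i)
    (hQ : Q ∈ irredFinset F j) (h : P ≠ Q) : IsCoprime P Q := by
  rw [mem_irredFinset] at hP hQ
  refine (hP.2.1.coprime_iff_not_dvd).2 fun hd => h ?_
  exact eq_of_monic_of_associated hP.1 hQ.1 (hP.2.1.associated_of_dvd hQ.2.1 hd)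

theorem prod_prod_dvd_iff {T : Finset ℕ} {D : T → Finset F[X]}
    (hD : ∀ i, D i ⊆ irredFinset F i) (g : F[X]) :
    ∏ i, ∏ P ∈ D i, P ∣ g ↔ ∀ i, ∀ P ∈ D i, P ∣ g := by
  constructor
  · intro h i P hP
    exact ((Finset.dvd_prod_of_mem _ hP).trans
      (Finset.dvd_prod_of_mem (fun i => ∏ P ∈ D i, P) (Finset.mem_univ i))).trans h
  · intro h
    refine Finset.prod_dvd_of_coprime ?_ fun i _ => Finset.prod_dvd_of_coprime ?_ (h i)
    · intro i _ j _ hij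
      refine IsCoprime.prod_left fun P hP => IsCoprime.prod_right fun Q hQ =>
        isCoprime_of_mem_irredFinset (hD i hP) (hD j hQ) ?_
      rintro rfl
      have h1 := (mem_irredFinset.1 (hD i hP)).2.2
      have h2 := (mem_irredFinset.1 (hD j hQ)).2.2
      exact hij (Subtype.ext (h1.symm.trans h2))
    · exact fun P hP Q hQ hPQ => isCoprime_of_mem_irredFinset (hD i hP) (hD i hQ) hPQ

end Monic

/-! ### Sieving by sets of irreducible divisors -/

section Sieve

theorem addChar_map_sum {G ι : Type*} [AddCommMonoid G] (ψ : AddChar G ℂ) (s : Finset ι)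
    (f : ι → G) : ψ (∑ i ∈ s, f i) = ∏ i ∈ s, ψ (f i) := by
  classical
  induction s using Finset.induction_on with
  | empty => simp
  | insert a s ha ih => rw [Finset.sum_insert ha, Finset.prod_insert ha, AddChar.map_add_eq_mul, ih]

variable {F : Type*} [Field F] [Finite F]

/-- The elementary symmetric function of degree `k` of the values `ψ(P_1)`, `P ∈ I_i`. -/
def irredEsymm (ψ : AddChar F ℂ) (i k : ℕ) : ℂ :=
  ∑ D ∈ (irredFinset F i).powersetCard k, ∏ P ∈ D, ψ P.nextCoeff

open Classical in
theorem numFactors_eq_card (i : ℕ) (g : F[X]) :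
    numFactors i g = ((irredFinset F i).filter (· ∣ g)).card := by
  rw [numFactors, ← Set.ncard_coe_finset]
  congr 1
  ext h
  simp [irred]

/-- This bound is what lets the binomial inversion be truncated at `k ≤ m`. -/
theorem numFactors_le {i m : ℕ} (hi : 0 < i) {g : F[X]} (hg : g ∈ monicFinset F m) :
    numFactors i g ≤ m := by
  classical
  rw [mem_monicFinset] at hg
  rw [numFactors_eq_card]
  set D := (irredFinset F i).filter (· ∣ g) with hD
  have hdvd : ∏ P ∈ D, P ∣ g := by
    refine Finset.prod_dvd_of_coprime (fun P hP Q hQ h => ?_)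
      fun P hP => (Finset.mem_filter.1 hP).2
    exact isCoprime_of_mem_irredFinset (Finset.mem_filter.1 hP).1 (Finset.mem_filter.1 hQ).1 h
  have h := natDegree_le_of_dvd hdvd hg.1.ne_zero
  rw [natDegree_prod_of_monic _ _ fun P hP =>
      (mem_irredFinset.1 (Finset.mem_filter.1 hP).1).1,
    Finset.sum_congr rfl fun P hP => (mem_irredFinset.1 (Finset.mem_filter.1 hP).1).2.2,
    Finset.sum_const, smul_eq_mul, hg.2] at h
  exact (Nat.le_mul_of_pos_right _ hi).trans h

-- The left side counts families of sets of irreducible divisors of `g`; by coprimality, such a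
-- family is detected by divisibility by a single product.
open Classical in
theorem prod_choose_numFactors (T : Finset ℕ) (k : T → ℕ) (g : F[X]) :
    ∏ i : T, (numFactors i g).choose (k i) =
      ∑ D ∈ Fintype.piFinset fun i : T => (irredFinset F i).powersetCard (k i),
        if ∏ i, ∏ P ∈ D i, P ∣ g then 1 else 0 := by
  have h (i : T) : (numFactors i g).choose (k i) =
      ∑ D ∈ (irredFinset F i).powersetCard (k i), if ∀ P ∈ D, P ∣ g then 1 else 0 := by
    rw [numFactors_eq_card, ← Finset.card_powersetCard, Finset.sum_boole, Nat.cast_id]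
    congr 1
    ext D
    simp only [Finset.mem_powersetCard, Finset.mem_filter, Finset.subset_iff]
    grind
  simp_rw [h]
  rw [Finset.prod_univ_sum]
  refine Finset.sum_congr rfl fun D hD => ?_
  rw [Finset.prod_boole]
  congr 1
  rw [prod_prod_dvd_iff fun i => (Finset.mem_powersetCard.1 (Fintype.mem_piFinset.1 hD i)).1]
  simp

theorem sum_monicFinset_prod_choose (ψ : AddChar F ℂ) (m : ℕ) (T : Finset ℕ) (k : T → ℕ) :
    ∑ g ∈ monicFinset F m, ψ g.nextCoeff * ∏ i : T, ((numFactors i g).choose (k i) : ℂ) =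
      if ∑ i : T, (i : ℕ) * k i ≤ m then
        (∏ i : T, irredEsymm ψ i (k i)) *
          ∑ h ∈ monicFinset F (m - ∑ i : T, (i : ℕ) * k i), ψ h.nextCoeff
      else 0 := by
  classical
  have h1 (g : F[X]) : ψ g.nextCoeff * ∏ i : T, ((numFactors i g).choose (k i) : ℂ) =
      ∑ D ∈ Fintype.piFinset fun i : T => (irredFinset F i).powersetCard (k i),
        if ∏ i, ∏ P ∈ D i, P ∣ g then ψ g.nextCoeff else 0 := by
    rw [← Nat.cast_prod, prod_choose_numFactors, Nat.cast_sum, Finset.mul_sum]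
    exact Finset.sum_congr rfl fun D _ => by split_ifs <;> simp
  simp_rw [h1]
  rw [Finset.sum_comm]
  have h2 : ∀ D ∈ Fintype.piFinset fun i : T => (irredFinset F i).powersetCard (k i),
      (∑ g ∈ monicFinset F m, if ∏ i, ∏ P ∈ D i, P ∣ g then ψ g.nextCoeff else 0) =
      if ∑ i : T, (i : ℕ) * k i ≤ m then
        (∏ i : T, ∏ P ∈ D i, ψ P.nextCoeff) *
          ∑ h ∈ monicFinset F (m - ∑ i : T, (i : ℕ) * k i), ψ h.nextCoeff
      else 0 := by
    intro D hD
    have hmem (i : T) := Finset.mem_powersetCard.1 (Fintype.mem_piFinset.1 hD i)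
    have hmon (i : T) : ∀ P ∈ D i, P.Monic := fun P hP =>
      (mem_irredFinset.1 ((hmem i).1 hP)).1
    have hQ : (∏ i, ∏ P ∈ D i, P).Monic :=
      monic_prod_of_monic _ _ fun i _ => monic_prod_of_monic _ _ (hmon i)
    have hdeg : (∏ i, ∏ P ∈ D i, P).natDegree = ∑ i : T, (i : ℕ) * k i := by
      rw [natDegree_prod_of_monic _ _ fun i _ => monic_prod_of_monic _ _ (hmon i)]
      refine Finset.sum_congr rfl fun i _ => ?_
      rw [natDegree_prod_of_monic _ _ (hmon i),
        Finset.sum_congr rfl fun P hP => (mem_irredFinset.1 ((hmem i).1 hP)).2.2,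
        Finset.sum_const, smul_eq_mul, (hmem i).2, mul_comm]
    have hnext : ψ (∏ i, ∏ P ∈ D i, P).nextCoeff = ∏ i : T, ∏ P ∈ D i, ψ P.nextCoeff := by
      rw [Monic.nextCoeff_prod _ _ fun i _ => monic_prod_of_monic _ _ (hmon i),
        addChar_map_sum]
      refine Finset.prod_congr rfl fun i _ => ?_
      rw [Monic.nextCoeff_prod _ _ (hmon i), addChar_map_sum]
    rw [← Finset.sum_filter, sum_monicFinset_dvd ψ m hQ, hdeg, hnext]
  rw [Finset.sum_congr rfl h2]
  split_ifs
  · rw [← Finset.sum_mul]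
    simp_rw [irredEsymm]
    rw [Finset.prod_univ_sum]
  · simp

/-- Binomial inversion: the indicator of `R = r` in terms of the numbers `R.choose k`. -/
theorem sum_choose_mul_choose_neg_one_zpow {m R : ℕ} (hR : R ≤ m) (r : ℕ) :
    ∑ k ∈ Finset.range (m + 1),
      (R.choose k : ℂ) * ((k.choose r : ℂ) * (-1) ^ ((k : ℤ) - (r : ℤ))) =
      if R = r then 1 else 0 := by
  have h0 : ∀ k ∈ Finset.range (m + 1), ¬ (r ≤ k ∧ k ≤ R) →
      (R.choose k : ℂ) * ((k.choose r : ℂ) * (-1) ^ ((k : ℤ) - (r : ℤ))) = 0 := by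
    intro k _ hk
    rcases lt_or_ge k r with h | h
    · simp [Nat.choose_eq_zero_of_lt h]
    · simp [Nat.choose_eq_zero_of_lt (show R < k by omega)]
  rcases lt_or_ge R r with h | h
  · rw [if_neg h.ne]
    exact Finset.sum_eq_zero fun k hk => h0 k hk (by omega)
  obtain ⟨s, rfl⟩ := Nat.exists_eq_add_of_le h
  have h1 : ∑ j ∈ Finset.range (s + 1), ((-1 : ℂ) ^ j * (s.choose j : ℂ)) =
      if s = 0 then 1 else 0 := by
    exact_mod_cast congrArg (Int.cast (R := ℂ)) (Int.alternating_sum_range_choose (n := s))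
  have h2 : ∑ k ∈ Finset.range (m + 1),
      ((r + s).choose k : ℂ) * ((k.choose r : ℂ) * (-1) ^ ((k : ℤ) - (r : ℤ))) =
      ∑ j ∈ Finset.range (s + 1), ((r + s).choose r : ℂ) * ((-1) ^ j * (s.choose j : ℂ)) := by
    symm
    -- Only `r ≤ k ≤ r + s` contributes, so the summation ranges need to match on nonzero terms
    -- only.
    refine Finset.sum_bij_ne_zero (fun j _ _ => r + j) ?_ ?_ ?_ ?_
    · intro j hj _
      simp only [Finset.mem_range] at hj ⊢
      omega
    · intro a _ _ b _ _ hab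
      omega
    · intro k hk hne
      have hk' : r ≤ k ∧ k ≤ r + s := by
        by_contra hcon
        exact hne (h0 k hk hcon)
      refine ⟨k - r, by simp only [Finset.mem_range]; omega, ?_, by omega⟩
      have : s.choose (k - r) ≠ 0 := (Nat.choose_pos (by omega)).ne'
      have : (r + s).choose r ≠ 0 := (Nat.choose_pos (by omega)).ne'
      simp [*]
    · intro j hj _
      have h3 := Nat.choose_mul (n := r + s) (k := r + j) (s := r) (by omega)
      have h4 : ((r + s).choose (r + j) : ℂ) * ((r + j).choose r : ℂ) =
          (r + s).choose r * s.choose j := by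
        rw [Nat.add_sub_cancel_left, Nat.add_sub_cancel_left] at h3
        exact_mod_cast h3
      rw [Nat.cast_add, add_sub_cancel_left, zpow_natCast, ← mul_assoc, ← mul_assoc, h4]
      ring
  rw [h2, ← Finset.mul_sum, h1]
  rcases Nat.eq_zero_or_pos s with rfl | hs
  · simp
  · simp [hs.ne']

open Classical in
/-- The sum of `ψ(g_1)` over the monic polynomials `g` of degree `m` with the prescribed numbers of
irreducible factors. -/
def patternSum (ψ : AddChar F ℂ) (m : ℕ) (T : Finset ℕ) (r : ℕ → ℕ) : ℂ :=
  ∑ g ∈ monicFinset F m with ∀ i ∈ T, numFactors i g = r i, ψ g.nextCoeff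

theorem patternSum_eq (ψ : AddChar F ℂ) (m : ℕ) {T : Finset ℕ} (hT : ∀ i ∈ T, 0 < i)
    (r : ℕ → ℕ) :
    patternSum ψ m T r =
      ∑ k ∈ Fintype.piFinset (fun _ : T => Finset.range (m + 1)),
        (∏ i : T, (((k i).choose (r i) : ℂ) * (-1) ^ ((k i : ℤ) - (r i : ℤ)))) *
          if ∑ i : T, (i : ℕ) * k i ≤ m then
            (∏ i : T, irredEsymm ψ i (k i)) *
              ∑ h ∈ monicFinset F (m - ∑ i : T, (i : ℕ) * k i), ψ h.nextCoeff
          else 0 := by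
  classical
  have h1 : ∀ g ∈ monicFinset F m,
      (if ∀ i ∈ T, numFactors i g = r i then ψ g.nextCoeff else 0) =
      ∑ k ∈ Fintype.piFinset (fun _ : T => Finset.range (m + 1)),
        (∏ i : T, (((k i).choose (r i) : ℂ) * (-1) ^ ((k i : ℤ) - (r i : ℤ)))) *
          (ψ g.nextCoeff * ∏ i : T, ((numFactors i g).choose (k i) : ℂ)) := by
    intro g hg
    have h2 : (if ∀ i ∈ T, numFactors i g = r i then (1 : ℂ) else 0) =
        ∏ i : T, if numFactors i g = r i then (1 : ℂ) else 0 := by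
      rw [Finset.prod_boole]
      simp
    have h3 : (if ∀ i ∈ T, numFactors i g = r i then ψ g.nextCoeff else 0) =
        ψ g.nextCoeff * if ∀ i ∈ T, numFactors i g = r i then (1 : ℂ) else 0 := by
      simp
    rw [h3, h2, Finset.prod_congr rfl fun (i : T) _ =>
      (sum_choose_mul_choose_neg_one_zpow (numFactors_le (hT i i.2) hg) (r i)).symm,
      Finset.prod_univ_sum, Finset.mul_sum]
    refine Finset.sum_congr rfl fun k _ => ?_
    rw [Finset.prod_mul_distrib]
    ring
  rw [patternSum, Finset.sum_filter, Finset.sum_congr rfl h1, Finset.sum_comm]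
  refine Finset.sum_congr rfl fun k _ => ?_
  rw [← Finset.mul_sum, sum_monicFinset_prod_choose]

end Sieve

end

end PolyPattern

namespace PolyPattern

noncomputable section

/-! ### Minimal polynomials and traces in a finite extension -/

section Extension

variable {F K : Type*} [Field F] [Field K] [Algebra F K]

theorem trace_eq_natDegree_minpoly [FiniteDimensional F K] (x : K) :
    Algebra.trace F K x =
      ((Module.finrank F K / (minpoly F x).natDegree : ℕ) : F) * -(minpoly F x).nextCoeff := by
  have hint : IsIntegral F x := .of_finite F x
  rw [trace_eq_finrank_mul_minpoly_nextCoeff, ← IntermediateField.adjoin.finrank hint,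
    ← Module.finrank_mul_finrank F (IntermediateField.adjoin F {x}) K,
    Nat.mul_div_cancel_left _ Module.finrank_pos]

variable [Finite F] [Fintype K]

-- Roots of `P` in `K` correspond to embeddings of `AdjoinRoot P` into `K`, and a field of degree
-- `d` dividing `[K : F]` has exactly `d` of them.
open Classical in
theorem card_filter_minpoly_eq {d : ℕ} (hd : d ∣ Module.finrank F K) {P : F[X]}
    (hP : P ∈ irredFinset F d) :
    (Finset.univ.filter fun x : K => minpoly F x = P).card = d := by
  rw [mem_irredFinset] at hP
  obtain ⟨hm, hirr, rfl⟩ := hP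
  have := Fact.mk hirr
  have hfin : Module.finrank F (AdjoinRoot P) = P.natDegree := by
    rw [(AdjoinRoot.powerBasis hirr.ne_zero).finrank, AdjoinRoot.powerBasis_dim]
  have h := FiniteField.natCard_algHom_of_finrank_dvd (F := F) (K := AdjoinRoot P) (L := K)
    (hfin ▸ hd)
  rw [hfin, Nat.card_congr (AdjoinRoot.equiv K F P hirr.ne_zero)] at h
  rw [← h, Nat.subtype_card]
  intro x
  rw [Finset.mem_filter, mem_aroots]
  constructor
  · rintro ⟨_, rfl⟩
    exact ⟨hirr.ne_zero, minpoly.aeval F x⟩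
  · rintro ⟨_, hx⟩
    exact ⟨Finset.mem_univ _, (minpoly.eq_of_irreducible_of_monic hirr hx hm).symm⟩

theorem sum_minpoly (h : F[X] → ℕ) :
    ∑ x : K, h (minpoly F x) =
      ∑ d ∈ (Module.finrank F K).divisors, ∑ P ∈ irredFinset F d, d * h P := by
  classical
  have hint (x : K) : IsIntegral F x := .of_finite F x
  rw [← Finset.sum_fiberwise_of_maps_to (s := Finset.univ)
    (t := (Module.finrank F K).divisors.biUnion (irredFinset F)) (g := fun x : K => minpoly F x),
    Finset.sum_biUnion]
  · refine Finset.sum_congr rfl fun d hd => Finset.sum_congr rfl fun P hP => ?_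
    rw [Finset.sum_congr rfl fun x hx => by rw [(Finset.mem_filter.1 hx).2],
      Finset.sum_const, card_filter_minpoly_eq (Nat.dvd_of_mem_divisors hd) hP, smul_eq_mul]
  · intro i _ j _ hij
    refine Finset.disjoint_left.2 fun P hP hQ => hij ?_
    rw [← (mem_irredFinset.1 hP).2.2, (mem_irredFinset.1 hQ).2.2]
  · intro x _
    rw [Finset.mem_biUnion]
    refine ⟨(minpoly F x).natDegree, Nat.mem_divisors.2 ⟨minpoly.degree_dvd (hint x),
      Module.finrank_pos.ne'⟩, mem_irredFinset.2 ⟨minpoly.monic (hint x),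
      minpoly.irreducible (hint x), rfl⟩⟩

open Classical in
theorem card_filter_trace_eq (b : F) :
    (Finset.univ.filter fun x : K => Algebra.trace F K x = b).card =
      Nat.card F ^ (Module.finrank F K - 1) := by
  have := Fintype.ofFinite F
  have hfib (c : F) : (Finset.univ.filter fun x : K => Algebra.trace F K x = c).card =
      (Finset.univ.filter fun x : K => Algebra.trace F K x = b).card :=
    AddMonoidHom.card_fiber_eq_of_mem_range (Algebra.trace F K)
      (Algebra.trace_surjective F K c) (Algebra.trace_surjective F K b)
  have h := Finset.card_eq_sum_card_fiberwise (s := (Finset.univ : Finset K))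
    (t := (Finset.univ : Finset F)) (f := Algebra.trace F K) (fun _ _ => Finset.mem_univ _)
  rw [Finset.sum_congr rfl fun c _ => hfib c, Finset.sum_const, smul_eq_mul, Finset.card_univ,
    Finset.card_univ, Module.card_eq_pow_finrank (K := F), ← Nat.card_eq_fintype_card] at h
  obtain ⟨n, hn⟩ := Nat.exists_eq_succ_of_ne_zero (Module.finrank_pos (R := F) (M := K)).ne'
  rw [hn, pow_succ', Nat.mul_right_inj Nat.card_pos.ne'] at h
  rw [hn, Nat.succ_sub_one, h]

end Extension

/-! ### Counting irreducibles by second coefficient -/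

section Count

variable {F : Type*} [Field F] [Finite F]

/-- The number of monic irreducible polynomials of degree `i` with second coefficient `b`. -/
def irredCount (i : ℕ) (b : F) : ℕ := by
  classical exact ((irredFinset F i).filter fun P => P.nextCoeff = b).card

theorem sum_irredCount [Fintype F] (i : ℕ) :
    ∑ b : F, irredCount i b = (irredFinset F i).card := by
  classical
  rw [Finset.card_eq_sum_card_fiberwise (t := Finset.univ) (f := fun P : F[X] => P.nextCoeff)
    (fun _ _ => Finset.mem_univ _)]
  exact Finset.sum_congr rfl fun b _ => by unfold irredCount; congr

theorem sum_divisors_card_irredFinset (p : ℕ) [Fact p.Prime] [CharP F p] {n : ℕ} (hn : 0 < n) :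
    ∑ d ∈ n.divisors, d * (irredFinset F d).card = Nat.card F ^ n := by
  have : NeZero n := ⟨hn.ne'⟩
  have := Fintype.ofFinite (FiniteField.Extension F p n)
  have h := sum_minpoly (F := F) (K := FiniteField.Extension F p n) fun _ => 1
  rw [FiniteField.finrank_extension, Finset.sum_const, Finset.card_univ,
    ← Nat.card_eq_fintype_card, FiniteField.natCard_extension, smul_eq_mul, mul_one] at h
  rw [h]
  exact Finset.sum_congr rfl fun d _ => by rw [Finset.sum_const, smul_eq_mul]; ring

/-- Both sides count the elements of trace `b` in the extension of degree `n`. An element with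
minimal polynomial `P` of degree `d` has trace `-(n / d) * P.nextCoeff`, which is zero, hence not
`b`, when `p ∣ n / d`. -/
theorem sum_divisors_irredCount (p : ℕ) [Fact p.Prime] [CharP F p] {n : ℕ} (hn : 0 < n)
    {b : F} (hb : b ≠ 0) :
    ∑ d ∈ n.divisors, (if p ∣ n / d then 0 else d * irredCount d (-(b / (n / d : ℕ)))) =
      Nat.card F ^ (n - 1) := by
  classical
  have : NeZero n := ⟨hn.ne'⟩
  have := Fintype.ofFinite (FiniteField.Extension F p n)
  have h := sum_minpoly (F := F) (K := FiniteField.Extension F p n) fun P =>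
    if ((n / P.natDegree : ℕ) : F) * -P.nextCoeff = b then 1 else 0
  have h2 (x : FiniteField.Extension F p n) :=
    (trace_eq_natDegree_minpoly (F := F) x).symm
  simp_rw [FiniteField.finrank_extension] at h h2
  simp_rw [h2] at h
  rw [Finset.sum_boole, card_filter_trace_eq, FiniteField.finrank_extension, Nat.cast_id] at h
  rw [h]
  refine Finset.sum_congr rfl fun d _ => ?_
  rw [Finset.sum_congr rfl fun P hP => by rw [(mem_irredFinset.1 hP).2.2], ← Finset.mul_sum]
  split_ifs with hp
  · rw [(CharP.cast_eq_zero_iff F p _).2 hp]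
    simp [hb.symm]
  · have hne : ((n / d : ℕ) : F) ≠ 0 := fun h0 => hp ((CharP.cast_eq_zero_iff F p _).1 h0)
    rw [Finset.sum_boole, Nat.cast_id, irredCount]
    congr 2
    ext P
    simp only [Finset.mem_filter, and_congr_right_iff]
    intro _
    rw [mul_comm, ← eq_div_iff hne, neg_eq_iff_eq_neg]

/-- The trace count is the same for every nonzero value; by induction the proper divisors contribute
equally, so the term `d = i` does too. -/
theorem irredCount_eq_irredCount (p : ℕ) [Fact p.Prime] [CharP F p] {i : ℕ} (hi : 0 < i)
    {b c : F} (hb : b ≠ 0) (hc : c ≠ 0) :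
    irredCount i b = irredCount i c := by
  induction i using Nat.strong_induction_on generalizing b c with
  | _ i ih =>
    have hp1 : ¬ p ∣ 1 := (Fact.out : p.Prime).one_lt.ne' ∘ Nat.dvd_one.1
    have h := (sum_divisors_irredCount p hi (neg_ne_zero.2 hb)).trans
      (sum_divisors_irredCount p hi (neg_ne_zero.2 hc)).symm
    rw [← Nat.cons_self_properDivisors hi.ne', Finset.sum_cons, Finset.sum_cons,
      Nat.div_self hi, if_neg hp1, if_neg hp1] at h
    have h2 : ∀ d ∈ i.properDivisors,
        (if p ∣ i / d then 0 else d * irredCount d (-(-b / (i / d : ℕ)))) =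
        (if p ∣ i / d then 0 else d * irredCount d (-(-c / (i / d : ℕ)))) := by
      intro d hd
      rw [Nat.mem_properDivisors] at hd
      split_ifs with hp
      · rfl
      · have hne : ((i / d : ℕ) : F) ≠ 0 := fun h0 => hp ((CharP.cast_eq_zero_iff F p _).1 h0)
        rw [ih d hd.2 (Nat.pos_of_dvd_of_pos hd.1 hi)
          (neg_ne_zero.2 (div_ne_zero (neg_ne_zero.2 hb) hne))
          (neg_ne_zero.2 (div_ne_zero (neg_ne_zero.2 hc) hne))]
    rw [Finset.sum_congr rfl h2, add_left_inj, Nat.mul_right_inj hi.ne'] at h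
    simpa using h

end Count

/-! ### Möbius inversion and the numbers `a_i`, `b_i` -/

section Moebius

open ArithmeticFunction

/-- Möbius inversion for sums over the divisors with `p`-free codivisor. -/
theorem sum_moebius_mul_eq_of_sum_eq {p : ℕ} (hp : p.Prime) {f g : ℕ → ℚ}
    (h : ∀ n, 0 < n → ∑ d ∈ n.divisors, (if p ∣ n / d then 0 else f d) = g n)
    {n : ℕ} (hn : 0 < n) :
    ∑ k ∈ n.divisors with ¬ p ∣ k, (moebius k : ℚ) * g (n / k) = f n := by
  let U : ArithmeticFunction ℚ := ⟨fun n => if p ∣ n then 0 else 1, by simp⟩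
  let V : ArithmeticFunction ℚ := ⟨fun n => if p ∣ n then 0 else (moebius n : ℚ), by simp⟩
  let f' : ArithmeticFunction ℚ := ⟨fun n => if n = 0 then 0 else f n, by simp⟩
  have hU (n : ℕ) : U n = if p ∣ n then 0 else 1 := rfl
  have hV (n : ℕ) : V n = if p ∣ n then 0 else (moebius n : ℚ) := rfl
  have hf (n : ℕ) : f' n = if n = 0 then 0 else f n := rfl
  -- For `n` prime to `p` this is `μ * ζ = 1`; for `p ∣ n` every factorization of `n` has a factor
  -- divisible by `p`, so all terms vanish.
  have hVU : V * U = 1 := by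
    ext n
    rw [← coe_moebius_mul_coe_zeta, mul_apply, mul_apply]
    by_cases hpn : p ∣ n
    · rcases Nat.eq_zero_or_pos n with rfl | hn
      · simp
      · have h1 : ((moebius : ArithmeticFunction ℚ) * (zeta : ArithmeticFunction ℚ)) n = 0 := by
          rw [coe_moebius_mul_coe_zeta, one_apply_ne]
          rintro rfl
          exact hp.one_lt.ne' (Nat.dvd_one.1 hpn)
        rw [← mul_apply (f := (moebius : ArithmeticFunction ℚ)), h1]
        refine Finset.sum_eq_zero fun x hx => ?_
        rw [Nat.mem_divisorsAntidiagonal] at hx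
        rw [← hx.1, hp.dvd_mul] at hpn
        rcases hpn with h | h <;> simp [hU, hV, h]
    · refine Finset.sum_congr rfl fun x hx => ?_
      rw [Nat.mem_divisorsAntidiagonal] at hx
      have h1 : ¬ p ∣ x.1 := fun h => hpn (hx.1 ▸ h.mul_right _)
      have h2 : ¬ p ∣ x.2 := fun h => hpn (hx.1 ▸ h.mul_left _)
      have h3 : x.2 ≠ 0 := fun h => h2 (h ▸ dvd_zero p)
      simp [hU, hV, h1, h2, h3]
  have hUf (n : ℕ) (hn : 0 < n) : (U * f') n = g n := by
    rw [← h n hn, mul_apply, Nat.sum_divisorsAntidiagonal' fun a b => U a * f' b]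
    refine Finset.sum_congr rfl fun d hd => ?_
    rw [hU, hf, if_neg (Nat.pos_of_mem_divisors hd).ne']
    split_ifs <;> simp
  have hfn : f n = (V * (U * f')) n := by
    rw [← mul_assoc, hVU, one_mul, hf, if_neg hn.ne']
  rw [hfn, mul_apply, Nat.sum_divisorsAntidiagonal fun a b => V a * (U * f') b, Finset.sum_filter]
  refine Finset.sum_congr rfl fun k hk => ?_
  rw [hUf _ (Nat.div_pos (Nat.divisor_le hk) (Nat.pos_of_mem_divisors hk)), hV]
  split_ifs <;> simp_all

variable {F : Type*} [Field F] [Finite F] {p : ℕ}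

theorem card_irredFinset_eq [Fact p.Prime] [CharP F p] {i : ℕ} (hi : 0 < i) :
    ((irredFinset F i).card : ℚ) =
      Nat.card F * aCoeff p (Nat.card F) i + bCoeff p (Nat.card F) i := by
  have hq : (Nat.card F : ℚ) ≠ 0 := by exact_mod_cast Nat.card_pos.ne'
  have hi' : (i : ℚ) ≠ 0 := by exact_mod_cast hi.ne'
  have h := (sum_eq_iff_sum_mul_moebius_eq (R := ℚ)
    (f := fun d => (d : ℚ) * (irredFinset F d).card) (g := fun n => (Nat.card F : ℚ) ^ n)).1
    (fun n hn => by exact_mod_cast sum_divisors_card_irredFinset (F := F) p hn) i hi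
  rw [Nat.sum_divisorsAntidiagonal fun a b => (moebius a : ℚ) * (Nat.card F : ℚ) ^ b,
    ← Finset.sum_filter_add_sum_filter_not _ (fun k => p ∣ k)] at h
  rw [aCoeff, bCoeff]
  field_simp
  linarith

theorem irredCount_of_ne_zero [Fact p.Prime] [CharP F p] {i : ℕ} (hi : 0 < i) {b : F}
    (hb : b ≠ 0) : (irredCount i b : ℚ) = aCoeff p (Nat.card F) i := by
  have hq : (Nat.card F : ℚ) ≠ 0 := by exact_mod_cast Nat.card_pos.ne'
  have hi' : (i : ℚ) ≠ 0 := by exact_mod_cast hi.ne'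
  have h := sum_moebius_mul_eq_of_sum_eq (Fact.out : p.Prime)
    (f := fun d => (d : ℚ) * irredCount d b) (g := fun n => (Nat.card F : ℚ) ^ (n - 1)) ?_ hi
  -- Trace fibres have size `q ^ (n - 1)`; pulling out one `q` accounts for the factor `1 / q` in
  -- `aCoeff`.
  · have h2 : ∑ k ∈ i.divisors with ¬ p ∣ k, (moebius k : ℚ) * (Nat.card F : ℚ) ^ (i / k) =
        Nat.card F * ∑ k ∈ i.divisors with ¬ p ∣ k,
          (moebius k : ℚ) * (Nat.card F : ℚ) ^ (i / k - 1) := by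
      rw [Finset.mul_sum]
      refine Finset.sum_congr rfl fun k hk => ?_
      have hk' := (Finset.mem_filter.1 hk).1
      have : 0 < i / k := Nat.div_pos (Nat.divisor_le hk') (Nat.pos_of_mem_divisors hk')
      obtain ⟨s, hs⟩ := Nat.exists_eq_succ_of_ne_zero this.ne'
      rw [hs, Nat.succ_sub_one, pow_succ]
      ring
    rw [aCoeff, h2, h]
    field_simp
  · intro n hn
    rw [← Nat.cast_pow, ← sum_divisors_irredCount p hn hb, Nat.cast_sum]
    refine Finset.sum_congr rfl fun d hd => ?_
    split_ifs with hp
    · simp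
    · have hne : ((n / d : ℕ) : F) ≠ 0 := fun h0 => hp ((CharP.cast_eq_zero_iff F p _).1 h0)
      rw [irredCount_eq_irredCount p (Nat.pos_of_mem_divisors hd) hb
        (neg_ne_zero.2 (div_ne_zero hb hne)), Nat.cast_mul]

/-- Of the `q a_i + b_i` irreducibles, the `q - 1` nonzero values take `a_i` each. -/
theorem irredCount_zero [Fact p.Prime] [CharP F p] {i : ℕ} (hi : 0 < i) :
    (irredCount i (0 : F) : ℚ) = aCoeff p (Nat.card F) i + bCoeff p (Nat.card F) i := by
  classical
  have := Fintype.ofFinite F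
  have h := congrArg (Nat.cast (R := ℚ)) (sum_irredCount (F := F) i)
  rw [card_irredFinset_eq (p := p) hi, Nat.cast_sum,
    ← Finset.add_sum_erase _ _ (Finset.mem_univ (0 : F)),
    Finset.sum_congr rfl fun b hb =>
      irredCount_of_ne_zero (p := p) hi (Finset.ne_of_mem_erase hb),
    Finset.sum_const, Finset.card_erase_of_mem (Finset.mem_univ _), Finset.card_univ, nsmul_eq_mul,
    Nat.cast_sub Fintype.card_pos, ← Nat.card_eq_fintype_card] at h
  push_cast at h
  linarith

end Moebius

end

end PolyPattern

namespace PolyPattern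

noncomputable section

/-! ### Coefficients of the generating series -/

section Series

theorem coeff_one_sub_neg_X_pow_pow_mul {p : ℕ} (hp : 0 < p) (n k : ℕ) (B : PowerSeries ℂ) :
    PowerSeries.coeff k ((1 - (-PowerSeries.X) ^ p) ^ n * B) =
      ∑ j ∈ Finset.range (k / p + 1),
        (n.choose j : ℂ) * PowerSeries.coeff (k - p * j) B * (-1) ^ (j + p * j) := by
  have h1 : ((1 : PowerSeries ℂ) - (-PowerSeries.X) ^ p) ^ n * B =
      ∑ j ∈ Finset.range (n + 1), PowerSeries.C ((n.choose j : ℂ) * (-1) ^ (j + p * j)) *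
        (PowerSeries.X ^ (p * j) * B) := by
    rw [sub_eq_neg_add, add_pow, Finset.sum_mul]
    refine Finset.sum_congr rfl fun j _ => ?_
    rw [neg_pow PowerSeries.X p, neg_pow (_ * _) j, mul_pow, ← pow_mul, ← pow_mul]
    simp only [map_mul, map_pow, map_neg, map_one, map_natCast, one_pow]
    ring
  have h2 (j : ℕ) : PowerSeries.coeff k (PowerSeries.C ((n.choose j : ℂ) * (-1) ^ (j + p * j)) *
      (PowerSeries.X ^ (p * j) * B)) = if p * j ≤ k then
        (n.choose j : ℂ) * PowerSeries.coeff (k - p * j) B * (-1) ^ (j + p * j) else 0 := by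
    rw [PowerSeries.coeff_C_mul, PowerSeries.coeff_X_pow_mul']
    split_ifs
    · ring
    · simp
  have h3 (j : ℕ) : p * j ≤ k ↔ j ∈ Finset.range (k / p + 1) := by
    rw [Finset.mem_range, Nat.lt_succ_iff, Nat.le_div_iff_mul_le hp, mul_comm]
  rw [h1, map_sum, Finset.sum_congr rfl fun j _ => h2 j]
  simp_rw [h3]
  rw [Finset.sum_ite_mem]
  -- The indices `n < j ≤ k / p` can be added freely, since `n.choose j = 0` there.
  refine Finset.sum_subset Finset.inter_subset_right fun j hj hj' => ?_
  have : n < j := by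
    by_contra hcon
    exact hj' (Finset.mem_inter.2 ⟨Finset.mem_range.2 (by omega), hj⟩)
  simp [Nat.choose_eq_zero_of_lt this]

/-- The case distinction in the definition of `A` is not needed. -/
theorem A_eq_sum {p : ℕ} (hp : 0 < p) (q k : ℕ) (a b : ℚ) :
    A p q k a b = ∑ j ∈ Finset.range (k / p + 1),
      Ring.choose (a * q / p) j * Ring.choose b (k - p * j) * (-1) ^ (j + p * j) := by
  rw [A]
  split_ifs with hb hk
  · obtain ⟨s, rfl⟩ := hk
    subst hb
    rw [Nat.mul_div_cancel_left _ hp, Finset.sum_eq_single s]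
    · simp [add_comm]
    · intro j hj hjs
      have hlt : p * j < p * s := Nat.mul_lt_mul_of_pos_left
        (lt_of_le_of_ne (Nat.lt_succ_iff.1 (Finset.mem_range.1 hj)) hjs) hp
      rw [Ring.choose_zero_pos ℚ (Nat.sub_pos_of_lt hlt)]
      simp
    · simp
  · subst hb
    symm
    refine Finset.sum_eq_zero fun j hj => ?_
    have hle : p * j ≤ k := by
      rw [Finset.mem_range, Nat.lt_succ_iff, Nat.le_div_iff_mul_le hp, mul_comm] at hj
      exact hj
    have hlt : p * j < k := lt_of_le_of_ne hle fun h => hk (h ▸ dvd_mul_right _ _)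
    rw [Ring.choose_zero_pos ℚ (Nat.sub_pos_of_lt hlt)]
    simp
  · rfl

theorem coeff_prod_one_add_C_mul_X {ι R : Type*} [CommRing R] (s : Finset ι) (f : ι → R)
    (k : ℕ) :
    PowerSeries.coeff k (∏ i ∈ s, (1 + PowerSeries.C (f i) * PowerSeries.X)) =
      ∑ D ∈ s.powersetCard k, ∏ i ∈ D, f i := by
  rw [Finset.prod_one_add, map_sum, Finset.powersetCard_eq_filter, Finset.sum_filter]
  refine Finset.sum_congr rfl fun D _ => ?_
  rw [Finset.prod_mul_distrib, Finset.prod_const, ← map_prod, PowerSeries.coeff_C_mul,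
    PowerSeries.coeff_X_pow]
  simp [eq_comm]

end Series

/-! ### Elementary symmetric functions of character values -/

section Esymm

variable {F : Type*} [Field F] [Fintype F] {p : ℕ} [Fact p.Prime] [CharP F p]

/-- A nontrivial `ψ` takes each `p`-th root of unity `q / p` times, and `∏ (1 + ζ y) = 1 - (-y)^p`
over these roots. -/
theorem prod_one_add_addChar_mul {R : Type*} [CommRing R] [IsDomain R] {ψ : AddChar F R}
    (hψ : ψ ≠ 1) (y : R) :
    ∏ b : F, (1 + ψ b * y) = (1 - (-y) ^ p) ^ (Nat.card F / p) := by
  classical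
  have hp : p.Prime := Fact.out
  obtain ⟨b₀, hb₀⟩ := AddChar.ne_one_iff.1 hψ
  have hpow (b : F) : ψ b ^ p = 1 := by
    rw [← AddChar.map_nsmul_eq_pow, nsmul_eq_mul, CharP.cast_eq_zero, zero_mul,
      AddChar.map_zero_eq_one]
  have hprim : IsPrimitiveRoot (ψ b₀) p := by
    have := orderOf_eq_prime (hpow b₀) hb₀
    exact this ▸ IsPrimitiveRoot.orderOf _
  have hmem (b : F) : ψ b ∈ nthRootsFinset p (1 : R) := (mem_nthRootsFinset hp.pos 1).2 (hpow b)
  have hfib : ∀ z ∈ nthRootsFinset p (1 : R), (Finset.univ.filter fun b : F => ψ b = z).card =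
      (Finset.univ.filter fun b : F => ψ b = 1).card := by
    intro z hz
    obtain ⟨j, -, rfl⟩ := hprim.eq_pow_of_pow_eq_one ((mem_nthRootsFinset hp.pos 1).1 hz)
    symm
    -- Translation by `j • b₀` carries the kernel of `ψ` onto the fibre over `ψ b₀ ^ j`.
    refine Finset.card_nbij' (fun b => b + j • b₀) (fun b => b + -(j • b₀)) ?_ ?_ ?_ ?_
    · intro b hb
      simp only [Finset.coe_filter, Finset.mem_univ, true_and, Set.mem_ofPred_eq] at hb ⊢
      rw [AddChar.map_add_eq_mul, AddChar.map_nsmul_eq_pow, hb, one_mul]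
    · intro b hb
      simp only [Finset.coe_filter, Finset.mem_univ, true_and, Set.mem_ofPred_eq] at hb ⊢
      rw [AddChar.map_add_eq_mul, hb, ← AddChar.map_nsmul_eq_pow, ← AddChar.map_add_eq_mul,
        add_neg_cancel, AddChar.map_zero_eq_one]
    · intro b _
      simp
    · intro b _
      simp
  have hcard : Nat.card F / p = (Finset.univ.filter fun b : F => ψ b = 1).card := by
    have h := Finset.card_eq_sum_card_fiberwise (s := (Finset.univ : Finset F))
      (t := nthRootsFinset p (1 : R)) (f := ψ) (fun b _ => hmem b)
    rw [Finset.sum_congr rfl hfib, Finset.sum_const, hprim.card_nthRootsFinset, smul_eq_mul,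
      Finset.card_univ, ← Nat.card_eq_fintype_card] at h
    rw [h, Nat.mul_div_cancel_left _ hp.pos]
  have h1 := hprim.pow_sub_pow_eq_prod_sub_mul 1 (-y) hp.pos
  rw [one_pow] at h1
  rw [h1, hcard, ← Finset.prod_pow, ← Finset.prod_fiberwise_of_maps_to fun b _ => hmem b]
  refine Finset.prod_congr rfl fun z hz => ?_
  rw [Finset.prod_congr rfl fun b hb => by rw [(Finset.mem_filter.1 hb).2], Finset.prod_const,
    hfib z hz]
  ring

/-- Grouping by second coefficient gives every value the exponent `a_i`, except that zero has a
surplus `b_i`. As `b_i` may be negative, `(1 + X)^(b_i)` is written as a binomial series. -/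
theorem prod_irredFinset_eq {ψ : AddChar F ℂ} (hψ : ψ ≠ 1) {i : ℕ} (hi : 0 < i) :
    ∏ P ∈ irredFinset F i, (1 + PowerSeries.C (ψ P.nextCoeff) * PowerSeries.X) =
      (1 - (-PowerSeries.X) ^ p) ^ (Nat.card F / p * irredCount i (1 : F)) *
        PowerSeries.binomialSeries ℂ (bCoeff p (Nat.card F) i) := by
  classical
  set f : F → PowerSeries ℂ := fun b => 1 + PowerSeries.C (ψ b) * PowerSeries.X with hf
  set c := irredCount i (1 : F) with hc
  have hcount {b : F} (hb : b ≠ 0) : irredCount i b = c :=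
    irredCount_eq_irredCount p hi hb one_ne_zero
  have hzero : f 0 ^ irredCount i (0 : F) =
      f 0 ^ c * PowerSeries.binomialSeries ℂ (bCoeff p (Nat.card F) i) := by
    have h0 : f 0 = 1 + PowerSeries.X := by simp [hf]
    rw [h0, ← PowerSeries.binomialSeries_nat (R := ℚ), ← PowerSeries.binomialSeries_nat (R := ℚ),
      ← PowerSeries.binomialSeries_add, irredCount_zero (p := p) hi, hc,
      irredCount_of_ne_zero (p := p) hi one_ne_zero]
  have hprod : ∏ b, f b = (1 - (-PowerSeries.X) ^ p) ^ (Nat.card F / p) := by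
    -- The character is viewed with values in power series so that `y` can be the variable itself.
    have hψ' : (PowerSeries.C (R := ℂ)).toMonoidHom.compAddChar ψ ≠ 1 := by
      obtain ⟨b, hb⟩ := AddChar.ne_one_iff.1 hψ
      refine AddChar.ne_one_iff.2 ⟨b, fun h => hb (PowerSeries.C_injective ?_)⟩
      rw [map_one]
      exact h
    exact prod_one_add_addChar_mul hψ' PowerSeries.X
  have hfib : ∏ P ∈ irredFinset F i, f P.nextCoeff = ∏ b, f b ^ irredCount i b := by
    rw [← Finset.prod_fiberwise_of_maps_to (t := Finset.univ) (g := fun P : F[X] => P.nextCoeff)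
      (fun _ _ => Finset.mem_univ _)]
    refine Finset.prod_congr rfl fun b _ => ?_
    rw [Finset.prod_congr rfl fun P hP => by rw [(Finset.mem_filter.1 hP).2], Finset.prod_const,
      irredCount]
  rw [hfib, pow_mul, ← hprod, ← Finset.prod_pow,
    ← Finset.mul_prod_erase _ _ (Finset.mem_univ (0 : F)),
    ← Finset.mul_prod_erase _ (fun b => f b ^ c) (Finset.mem_univ (0 : F)), hzero,
    Finset.prod_congr rfl fun b hb => by rw [hcount (Finset.ne_of_mem_erase hb)]]
  ring

theorem irredEsymm_eq_A {ψ : AddChar F ℂ} (hψ : ψ ≠ 1) (hp : p ∣ Nat.card F) {i : ℕ}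
    (hi : 0 < i) (k : ℕ) :
    irredEsymm ψ i k =
      (A p (Nat.card F) k (aCoeff p (Nat.card F) i) (bCoeff p (Nat.card F) i) : ℚ) := by
  have hp' : p.Prime := Fact.out
  -- The upper index `a_i q / p` is a natural number because `a_i` is a cardinality and `p ∣ q`.
  have ha : aCoeff p (Nat.card F) i * (Nat.card F : ℕ) / p =
      ((Nat.card F / p * irredCount i (1 : F) : ℕ) : ℚ) := by
    rw [← irredCount_of_ne_zero (p := p) hi one_ne_zero, Nat.cast_mul,
      Nat.cast_div hp (by exact_mod_cast hp'.ne_zero)]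
    ring
  rw [A_eq_sum hp'.pos, ha, irredEsymm, ← coeff_prod_one_add_C_mul_X,
    prod_irredFinset_eq (p := p) hψ hi, coeff_one_sub_neg_X_pow_pow_mul hp'.pos, Rat.cast_sum]
  refine Finset.sum_congr rfl fun j _ => ?_
  rw [PowerSeries.binomialSeries_coeff, Ring.choose_natCast, Rat.smul_one_eq_cast]
  push_cast
  rfl

end Esymm

end

end PolyPattern

namespace PolyPattern

noncomputable section

/-! ### Orthogonality and evaluation of the two terms -/

section Final

variable {F : Type*} [Field F] [Finite F]

omit [Finite F] in
theorem bracket_one_eq_iff {g : F[X]} (hg : g.Monic) (α : F) :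
    bracket 1 g = bracket 1 (X + C α) ↔ g.nextCoeff = α := by
  have hα : (X + C α : F[X]).Monic := monic_X_add_C α
  have h1 : (X + C α : F[X]).nextCoeff = α := by
    rw [nextCoeff_of_natDegree_pos (by rw [natDegree_X_add_C]; exact one_pos), natDegree_X_add_C]
    simp
  rw [bracket, bracket, Ideal.Quotient.eq, Ideal.mem_span_singleton, X_pow_dvd_iff]
  constructor
  · intro h
    have := h 1 (by norm_num)
    rwa [coeff_sub, coeff_one_reverse, coeff_one_reverse, h1, sub_eq_zero] at this
  · intro h d hd
    interval_cases d
    · rw [coeff_sub, coeff_zero_reverse, coeff_zero_reverse, hg.leadingCoeff, hα.leadingCoeff,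
        sub_self]
    · rw [coeff_sub, coeff_one_reverse, coeff_one_reverse, h1, h, sub_self]

/-- Orthogonality of characters: `∑ ψ, ψ (g.nextCoeff - α)` is `q` or `0`. -/
theorem card_mul_N_eq_sum [Fintype F] (m : ℕ) (T : Finset ℕ) (r : ℕ → ℕ) (α : F) :
    (Nat.card F : ℂ) * (N 1 m T r (X + C α) : ℂ) =
      ∑ ψ : AddChar F ℂ, ψ (-α) * patternSum ψ m T r := by
  classical
  have hN : N 1 m T r (X + C α) = (((monicFinset F m).filter
      fun g => ∀ i ∈ T, numFactors i g = r i).filter fun g => g.nextCoeff = α).card := by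
    rw [N, ← Set.ncard_coe_finset]
    congr 1
    ext g
    simp only [Set.mem_ofPred_eq, Finset.coe_filter, Finset.mem_filter, mem_monicFinset]
    constructor
    · rintro ⟨h1, h2, h3, h4⟩
      exact ⟨⟨⟨h1, h2⟩, h4⟩, (bracket_one_eq_iff h1 α).1 h3⟩
    · rintro ⟨⟨⟨h1, h2⟩, h4⟩, h3⟩
      exact ⟨h1, h2, (bracket_one_eq_iff h1 α).2 h3, h4⟩
  have h1 (g : F[X]) : ∑ ψ : AddChar F ℂ, ψ (-α) * ψ g.nextCoeff =
      if g.nextCoeff = α then (Nat.card F : ℂ) else 0 := by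
    have h := AddChar.sum_apply_eq_ite (-α + g.nextCoeff)
    simp_rw [AddChar.map_add_eq_mul] at h
    rw [h, neg_add_eq_zero, Nat.card_eq_fintype_card]
    simp_rw [eq_comm (a := α)]
  simp_rw [patternSum, Finset.mul_sum]
  rw [Finset.sum_comm, Finset.sum_congr rfl fun g _ => h1 g, ← Finset.sum_filter,
    Finset.sum_const, hN, nsmul_eq_mul, mul_comm]

theorem sum_addChar_ne_one [Fintype F] [DecidableEq (AddChar F ℂ)] (α : F) :
    ∑ ψ ∈ Finset.univ.erase (1 : AddChar F ℂ), ψ (-α) = (v α : ℚ) := by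
  classical
  have h := AddChar.sum_apply_eq_ite (-α)
  rw [← Finset.add_sum_erase _ _ (Finset.mem_univ (1 : AddChar F ℂ)), AddChar.one_apply,
    neg_eq_zero] at h
  rw [v, eq_sub_of_add_eq' h, Nat.card_eq_fintype_card]
  by_cases hα : α = 0 <;> simp [hα]

theorem patternSum_eq_secondTerm {p : ℕ} [Fact p.Prime] [CharP F p] (hp : p ∣ Nat.card F)
    {ψ : AddChar F ℂ} (hψ : ψ ≠ 1) (m : ℕ) {T : Finset ℕ} (hT : ∀ i ∈ T, 0 < i) (r : ℕ → ℕ) :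
    patternSum ψ m T r = (secondTerm p (Nat.card F) m T r : ℚ) := by
  have := Fintype.ofFinite F
  rw [patternSum_eq ψ m hT, secondTerm, Rat.cast_sum]
  refine Finset.sum_congr rfl fun k _ => ?_
  rw [sum_monicFinset_addChar hψ]
  by_cases h : ∑ i : T, (i : ℕ) * k i = m
  · rw [if_pos h.le, if_pos (by omega), if_pos h, mul_one, mul_one, Rat.cast_prod,
      ← Finset.prod_mul_distrib]
    refine Finset.prod_congr rfl fun i _ => ?_
    rw [irredEsymm_eq_A (p := p) hψ hp (hT i i.2)]
    push_cast
    ring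
  · rw [if_neg h, mul_zero, Rat.cast_zero]
    -- The subtraction in `m - ∑ i * k i` is truncated, so its vanishing gives equality only
    -- together with `h1`.
    split_ifs with h1 h2
    · exact absurd (by omega) h
    · simp
    · simp

theorem irredEsymm_one (i k : ℕ) :
    irredEsymm (1 : AddChar F ℂ) i k = ((irred F i).ncard.choose k : ℂ) := by
  simp [irredEsymm, card_irredFinset]

/-- With `ψ = 1` the cofactor sum is a power of `q`; put `k = r + j` and use `C(n, r) C(n - r, j) =
C(n, r + j) C(r + j, r)`. -/
theorem patternSum_one_eq_mainTerm (m : ℕ) {T : Finset ℕ} (hT : ∀ i ∈ T, 0 < i) (r : ℕ → ℕ) :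
    patternSum (1 : AddChar F ℂ) m T r = (Nat.card F * mainTerm F m T r : ℚ) := by
  have hq : (Nat.card F : ℂ) ≠ 0 := by exact_mod_cast Nat.card_pos.ne'
  have hq' : (Nat.card F : ℚ) ≠ 0 := by exact_mod_cast Nat.card_pos.ne'
  have hterm (j : T → ℕ) :
      (((Nat.card F : ℚ) ^ (m : ℤ) * ((∏ i : T, (((irred F i).ncard.choose (r i) : ℚ) *
        (Nat.card F : ℚ) ^ (-((i : ℤ) * r i)) * ((Nat.card F : ℚ) ^ (-((i : ℤ) * j i)) *
          (((irred F i).ncard - r i).choose (j i) : ℚ) * (-1) ^ (j i)))) *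
        (if ∑ i : T, (i : ℕ) * (r i + j i) ≤ m then 1 else 0)) : ℚ) : ℂ) =
      (∏ i : T, (((r i + j i).choose (r i) : ℂ) * (-1) ^ (((r i + j i : ℕ) : ℤ) - (r i : ℤ)))) *
        if ∑ i : T, (i : ℕ) * (r i + j i) ≤ m then
          (∏ i : T, irredEsymm (1 : AddChar F ℂ) i (r i + j i)) *
            ∑ h ∈ monicFinset F (m - ∑ i : T, (i : ℕ) * (r i + j i)),
              (1 : AddChar F ℂ) h.nextCoeff
        else 0 := by
    split_ifs with h
    · have hsum : ∑ g ∈ monicFinset F (m - ∑ i : T, (i : ℕ) * (r i + j i)),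
          (1 : AddChar F ℂ) g.nextCoeff = (Nat.card F : ℂ) ^ (m : ℤ) *
            ∏ i : T, ((Nat.card F : ℂ) ^ (-((i : ℤ) * r i)) *
              (Nat.card F : ℂ) ^ (-((i : ℤ) * j i))) := by
        have hinv (i : T) : (Nat.card F : ℂ) ^ (-((i : ℤ) * r i)) *
            (Nat.card F : ℂ) ^ (-((i : ℤ) * j i)) =
            ((Nat.card F : ℂ) ^ ((i : ℕ) * (r i + j i)))⁻¹ := by
          rw [← zpow_add₀ hq, ← zpow_natCast, ← zpow_neg]
          push_cast
          ring_nf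
        simp only [AddChar.one_apply, Finset.sum_const, card_monicFinset, nsmul_eq_mul, mul_one]
        rw [Finset.prod_congr rfl fun i _ => hinv i, Finset.prod_inv_distrib,
          Finset.prod_pow_eq_pow_sum, Nat.cast_pow, zpow_natCast, pow_sub₀ _ hq h]
      have hchoose (i : T) : ((irred F i).ncard.choose (r i) : ℂ) *
          (((irred F i).ncard - r i).choose (j i) : ℂ) =
          ((irred F i).ncard.choose (r i + j i) : ℂ) * ((r i + j i).choose (r i) : ℂ) := by
        have h3 := Nat.choose_mul (n := (irred F i).ncard) (Nat.le_add_right (r i) (j i))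
        rw [Nat.add_sub_cancel_left] at h3
        exact_mod_cast h3.symm
      rw [hsum, mul_one, mul_left_comm (∏ i : T, irredEsymm _ _ _), mul_left_comm (∏ i : T, _),
        ← Finset.prod_mul_distrib, ← Finset.prod_mul_distrib]
      push_cast
      congr 1
      refine Finset.prod_congr rfl fun i _ => ?_
      rw [irredEsymm_one, add_sub_cancel_left, zpow_natCast]
      linear_combination ((Nat.card F : ℂ) ^ (-((i : ℤ) * r i)) *
        (Nat.card F : ℂ) ^ (-((i : ℤ) * j i)) * (-1) ^ (j i)) * hchoose i
    · simp
  rw [patternSum_eq _ m hT, mainTerm, ← mul_assoc, mul_comm (Nat.card F : ℚ),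
    ← zpow_add_one₀ hq', sub_add_cancel, Finset.mul_sum, Rat.cast_sum,
    Finset.sum_congr rfl fun j _ => hterm j]
  symm
  have hle {k : T → ℕ} (h : ∑ i : T, (i : ℕ) * k i ≤ m) (i : T) : k i ≤ m :=
    (Nat.le_mul_of_pos_left _ (hT i i.2)).trans
      ((Finset.single_le_sum (f := fun i : T => (i : ℕ) * k i) (fun _ _ => Nat.zero_le _)
        (Finset.mem_univ i)).trans h)
  -- The ranges `k i ≤ m` and `j i ≤ |I_i| - r i` differ, but nonzero terms lie in both. This also
  -- covers `r i > |I_i|`, where truncation leaves only `j i = 0`, with a zero term.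
  refine Finset.sum_bij_ne_zero (fun j _ _ i => r i + j i) ?_ ?_ ?_ fun _ _ _ => rfl
  · intro j _ hne
    refine Fintype.mem_piFinset.2 fun i => Finset.mem_range.2 (Nat.lt_succ_iff.2 ?_)
    refine hle (k := fun i => r i + j i) ?_ i
    by_contra hcon
    exact hne (by rw [if_neg hcon, mul_zero])
  · intro a _ _ b _ _ hab
    funext i
    exact Nat.add_left_cancel (congrFun hab i)
  · intro k hk hne
    have hsum : ∑ i : T, (i : ℕ) * k i ≤ m := by
      by_contra hcon
      exact hne (by rw [if_neg hcon, mul_zero])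
    rw [if_pos hsum] at hne
    have h1 (i : T) : r i ≤ k i := by
      by_contra! hcon
      exact left_ne_zero_of_mul (Finset.prod_ne_zero_iff.1 (left_ne_zero_of_mul hne) i
        (Finset.mem_univ i)) (by rw [Nat.choose_eq_zero_of_lt hcon, Nat.cast_zero])
    have h2 (i : T) : k i ≤ (irred F i).ncard := by
      by_contra! hcon
      exact Finset.prod_ne_zero_iff.1 (left_ne_zero_of_mul (right_ne_zero_of_mul hne)) i
        (Finset.mem_univ i)
        (by rw [irredEsymm_one, Nat.choose_eq_zero_of_lt hcon, Nat.cast_zero])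
    have h3 : (fun i : T => r i + (k i - r i)) = k :=
      funext fun i => Nat.add_sub_cancel' (h1 i)
    refine ⟨fun i => k i - r i, Fintype.mem_piFinset.2 fun i => Finset.mem_range.2 ?_, ?_, h3⟩
    · have := h1 i
      have := h2 i
      omega
    · have h4 (i : T) : r i + (k i - r i) = k i := Nat.add_sub_cancel' (h1 i)
      simp_rw [h4]
      rwa [if_pos hsum]

end Final

end

end PolyPattern

theorem theorem7p3 (p e : ℕ) (hp : p.Prime) (he : 0 < e)
    {F : Type*} [Field F] [Finite F] (hq : Nat.card F = p ^ e)
    (T : Finset ℕ) (hT : ∀ i ∈ T, 0 < i) (m : ℕ) (r : ℕ → ℕ) (α : F) :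
    (PolyPattern.N 1 m T r (X + C α : F[X]) : ℚ) =
      PolyPattern.mainTerm F m T r +
        PolyPattern.v α / (Nat.card F : ℚ) * PolyPattern.secondTerm p (Nat.card F) m T r := by
  classical
  have := Fact.mk hp
  have := Fintype.ofFinite F
  have : CharP F p := charP_of_card_eq_prime_pow (f := e) (by rw [← Nat.card_eq_fintype_card, hq])
  have hdvd : p ∣ Nat.card F := hq ▸ dvd_pow_self p he.ne'
  have hq0 : (Nat.card F : ℚ) ≠ 0 := by exact_mod_cast Nat.card_pos.ne'
  have h := PolyPattern.card_mul_N_eq_sum m T r α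
  -- All nontrivial characters share the same pattern sum, so their weights `ψ (-α)` simply add up
  -- to `v α`.
  rw [← Finset.add_sum_erase _ _ (Finset.mem_univ (1 : AddChar F ℂ)), AddChar.one_apply, one_mul,
    PolyPattern.patternSum_one_eq_mainTerm m hT, Finset.sum_congr rfl fun ψ hψ => by
      rw [PolyPattern.patternSum_eq_secondTerm hdvd (Finset.ne_of_mem_erase hψ) m hT],
    ← Finset.sum_mul, PolyPattern.sum_addChar_ne_one] at h
  have h' : (Nat.card F : ℚ) * (PolyPattern.N 1 m T r (X + C α : F[X]) : ℚ) =
      Nat.card F * PolyPattern.mainTerm F m T r +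
        PolyPattern.v α * PolyPattern.secondTerm p (Nat.card F) m T r := by
    exact_mod_cast h
  field_simp
  linarith
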